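/- Let $(\Omega,\mathcal F,P)$ be a probability space, let $r_1\le r_2$, and let $Y_n=\mathrm{vec}(Y_{1,n},Y_{2,n})$, $n\ge 1$, be centered random vectors on it, with $Y_{1,n}$ and $Y_{2,n}$ of dimensions $r_1$ and $r_2$. Assume that the covariance matrix of $Y_n$ has finite entries, does not depend on $n$, and equals a full-rank matrix \[ \varPsi=\begin{pmatrix}\varPsi_1&\varPsi_{12}\\ \varPsi_{12}^{\mathrm T}&\varPsi_2\end{pmatrix}, \] and that $Y_n$ converges in distribution to a random vector $Y=\mathrm{vec}(Y_1,Y_2)$ with the Normal law $N_{r_1+r_2}(0,\varPsi)$. Then \[ (Y_{1,n}^{\mathrm T}\varPsi_1^{-1}Y_{1,n},\;Y_{2,n}^{\mathrm T}\varPsi_2^{-1}Y_{2,n}) \] converges in distribution to $V=(V_1,V_2)=(Y_1^{\mathrm T}\varPsi_1^{-1}Y_1,\;Y_2^{\mathrm T}\varPsi_2^{-1}Y_2)$, and for all $t_1,t_2\ge 0$ the Laplace transform $L_V(t_1,t_2)=\mathrm E[e^{-t_1V_1-t_2V_2}]$ is \[ L_V(t_1,t_2)=(1+2t_2)^{-\frac12(r_2-r_1)}\prod_{j=1}^{r_1}\bigl(1+2t_1+2t_2+4(1-\rho_j^2)t_1t_2\bigr)^{-\frac12},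 \] where $1\ge\rho_1\ge\cdots\ge\rho_{r_1}\ge 0$ are the canonical correlations between $Y_1$ and $Y_2$, i.e. the singular values of $\varPsi_1^{-1/2}\varPsi_{12}\varPsi_2^{-1/2}$. Application. For $x\neq 0$ let $S(x)=10^{\langle\log_{10}|x|\rangle}$ be the significand of $x$ ($\langle\cdot\rangle$ is the fractional part) and $D(x)=\lfloor S(x)\rfloor$ its first digit; put $p_d=\log_{10}\frac{d+1}{d}$ and $C=\log_{10}e$. Let $X_1,X_2,\dots$ be independent Benford random variables, i.e. each $S(X_i)$ is distributed as $10^U$ with $U$ uniform on $[0,1)$. Let $Z(x)=\mathrm{vec}(Z_1(x),Z_2(x))$ with $Z_{1,d}(x)=\mathbf 1_{[d,d+1)}(S(x))$ for $d=1,\dots,8$ and $Z_{2,d}(x)=S(x)\mathbf 1_{[d,d+1)}(S(x))$ for $d=1,\dots,9$. Then each $Z(X_i)$ has mean $\mathrm{vec}(\mu_1,\mu_2)$, $\mu_1=(p_1,\dots,p_8)^{\mathrm T}$, $\mu_2=(C,\dots,C)^{\mathrm T}$, and covariance matrix $\varSigma$ with blocks $\varSigma_1=(p_d\delta_{d,d'}-p_dp_{d'})$,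 $\varSigma_{12}=(C\delta_{d,d'}-Cp_d)$, $\varSigma_2=(C(d+\frac12)\delta_{d,d'}-C^2)$. Let \[ Q_1=\sum_{d=1}^9\frac{(n\widehat p_d-np_d)^2}{np_d},\qquad Q_2=n(\bar Z_2-\mu_2)^{\mathrm T}\varSigma_2^{-1}(\bar Z_2-\mu_2), \] where $\widehat p_d=\frac1n\#\{i\le n:D(X_i)=d\}$ and $\bar Z_2=\frac1n\sum_{i\le n}Z_2(X_i)$. As $n\to\infty$, $(Q_1,Q_2)$ converges in distribution to the vector $V$ above built from $Y\sim N_{17}(0,\varSigma)$ with $r_1=8$, $r_2=9$, so that for all $t_1,t_2\ge 0$ \[ L_V(t_1,t_2)=(1+2t_2)^{-\frac12}\prod_{j=1}^{8}\bigl(1+2t_1+2t_2+4(1-\rho_j^2)t_1t_2\bigr)^{-\frac12}, \] with $\rho_1,\dots,\rho_8$ the singular values of $\varSigma_1^{-1/2}\varSigma_{12}\varSigma_2^{-1/2}$. -/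

import Mathlib

open MeasureTheory ProbabilityTheory Filter Topology
open scoped Matrix MatrixOrder

noncomputable section

namespace QuadPair

/-- The first block (of dimension `r₁`) of the vector `y = vec(y₁, y₂)`. -/
def fstBlock {r₁ r₂ : ℕ} (y : EuclideanSpace ℝ (Fin r₁ ⊕ Fin r₂)) : Fin r₁ → ℝ :=
  fun i => y (Sum.inl i)

/-- The second block (of dimension `r₂`) of the vector `y = vec(y₁, y₂)`. -/
def sndBlock {r₁ r₂ : ℕ} (y : EuclideanSpace ℝ (Fin r₁ ⊕ Fin r₂)) : Fin r₂ → ℝ :=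
  fun i => y (Sum.inr i)

/-- The quadratic form `xᵀ A⁻¹ x`. -/
def invQuadForm {r : ℕ} (A : Matrix (Fin r) (Fin r) ℝ) (x : Fin r → ℝ) : ℝ :=
  x ⬝ᵥ (A⁻¹ *ᵥ x)

/-- The pair `(y₁ᵀ Ψ₁⁻¹ y₁, y₂ᵀ Ψ₂⁻¹ y₂)`, where `Ψ₁`, `Ψ₂` are the diagonal blocks of `Ψ`. -/
def quadPair {r₁ r₂ : ℕ} (Ψ : Matrix (Fin r₁ ⊕ Fin r₂) (Fin r₁ ⊕ Fin r₂) ℝ)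
    (y : EuclideanSpace ℝ (Fin r₁ ⊕ Fin r₂)) : ℝ × ℝ :=
  (invQuadForm Ψ.toBlocks₁₁ (fstBlock y), invQuadForm Ψ.toBlocks₂₂ (sndBlock y))

/-- The canonical correlations, numbered from `0` in decreasing order: the singular values of
`Ψ₁^(-1/2) Ψ₁₂ Ψ₂^(-1/2)`; those of index at least `r₁` vanish. -/
def canonCorr {r₁ r₂ : ℕ} (Ψ : Matrix (Fin r₁ ⊕ Fin r₂) (Fin r₁ ⊕ Fin r₂) ℝ) (j : ℕ) : ℝ :=
  (Matrix.toEuclideanLin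
    ((CFC.sqrt Ψ.toBlocks₁₁)⁻¹ * Ψ.toBlocks₁₂ * (CFC.sqrt Ψ.toBlocks₂₂)⁻¹)).singularValues j

/-- The Laplace transform `E[exp(-t₁ V₁ - t₂ V₂)]` of a bivariate random vector `V`. -/
def laplace {Ω : Type*} [MeasurableSpace Ω] (P : Measure Ω) (V : Ω → ℝ × ℝ) (t₁ t₂ : ℝ) : ℝ :=
  ∫ ω, Real.exp (-t₁ * (V ω).1 - t₂ * (V ω).2) ∂P

end QuadPair

namespace Benford

/-- The significand function `S(x) = 10 ^ ⟨log₁₀ |x|⟩`, with values in `[1, 10)`; it matters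
only at `x ≠ 0`. -/
def significand (x : ℝ) : ℝ := (10 : ℝ) ^ Int.fract (Real.logb 10 |x|)

/-- The first significant digit `D(x) = ⌊S(x)⌋`. -/
def firstDigit (x : ℝ) : ℕ := ⌊significand x⌋₊

/-- The law of `10 ^ U` with `U` uniform on `[0, 1)`. -/
def significandLaw : Measure ℝ :=
  (volume.restrict (Set.Ico (0 : ℝ) 1)).map (fun u => (10 : ℝ) ^ u)

/-- `X` is a Benford random variable: its significand is distributed as `10 ^ U` with `U`
uniform on `[0, 1)`. -/
structure IsBenford {Ω : Type*} [MeasurableSpace Ω] (X : Ω → ℝ) (P : Measure Ω) : Prop where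
  aemeasurable : AEMeasurable X P
  hasLaw : HasLaw (fun ω => significand (X ω)) significandLaw P

/-- The first-digit probabilities `p_d = log₁₀ ((d + 1) / d)`. -/
def p (d : ℕ) : ℝ := Real.logb 10 (((d : ℝ) + 1) / d)

/-- The constant `C = log₁₀ e`. -/
def C : ℝ := Real.logb 10 (Real.exp 1)

/-- `Z_{1,d} = 1_{[d, d+1)}(S(x))`. -/
def Z₁ (d : ℕ) (x : ℝ) : ℝ :=
  Set.indicator (Set.Ico (d : ℝ) (d + 1)) (fun _ => 1) (significand x)

/-- `Z_{2,d} = S(x) 1_{[d, d+1)}(S(x))`. -/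
def Z₂ (d : ℕ) (x : ℝ) : ℝ := significand x * Z₁ d x

/-- The vector `Z = vec(Z₁, Z₂)`, with `Z₁ = (Z_{1,1}, …, Z_{1,8})` and
`Z₂ = (Z_{2,1}, …, Z_{2,9})`; the index `i` stands for the digit `i + 1`. -/
def Z (x : ℝ) : Fin 8 ⊕ Fin 9 → ℝ :=
  Sum.elim (fun i => Z₁ (i.val + 1) x) (fun i => Z₂ (i.val + 1) x)

/-- The mean vector `μ = vec(μ₁, μ₂)`. -/
def μ : Fin 8 ⊕ Fin 9 → ℝ := Sum.elim (fun i => p (i.val + 1)) (fun _ => C)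

/-- The covariance matrix of `Z₁`: `(p_d δ_{d,d'} - p_d p_{d'})`. -/
def cov₁ : Matrix (Fin 8) (Fin 8) ℝ :=
  Matrix.of fun i j => (if i = j then p (i.val + 1) else 0) - p (i.val + 1) * p (j.val + 1)

/-- The cross-covariance matrix of `Z₁` and `Z₂`: `(C δ_{d,d'} - C p_d)`. -/
def cov₁₂ : Matrix (Fin 8) (Fin 9) ℝ :=
  Matrix.of fun i j => (if i.val = j.val then C else 0) - C * p (i.val + 1)

/-- The covariance matrix of `Z₂`: `(C (d + 1/2) δ_{d,d'} - C²)`. -/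
def cov₂ : Matrix (Fin 9) (Fin 9) ℝ :=
  Matrix.of fun i j => (if i = j then C * (((i.val : ℝ) + 1) + 1 / 2) else 0) - C ^ 2

/-- The covariance matrix of `Z = vec(Z₁, Z₂)`. -/
def covZ : Matrix (Fin 8 ⊕ Fin 9) (Fin 8 ⊕ Fin 9) ℝ :=
  Matrix.fromBlocks cov₁ cov₁₂ cov₁₂ᵀ cov₂

/-- The relative frequency of the first digit `d` among the first `n` observations. -/
def pHat {Ω : Type*} (X : ℕ → Ω → ℝ) (n d : ℕ) (ω : Ω) : ℝ :=
  (1 / n) * ∑ i ∈ Finset.range n, if firstDigit (X i ω) = d then 1 else 0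

/-- The first-digit Pearson statistic of the first `n` observations. -/
def Q₁ {Ω : Type*} (X : ℕ → Ω → ℝ) (n : ℕ) (ω : Ω) : ℝ :=
  ∑ d ∈ Finset.Icc 1 9, (n * pHat X n d ω - n * p d) ^ 2 / (n * p d)

/-- The vector of the sample averages of `Z_{2,1}, …, Z_{2,9}`. -/
def Z₂Bar {Ω : Type*} (X : ℕ → Ω → ℝ) (n : ℕ) (ω : Ω) : Fin 9 → ℝ :=
  fun i => (1 / n) * ∑ k ∈ Finset.range n, Z₂ (i.val + 1) (X k ω)

/-- The Hotelling sum-invariance statistic of the first `n` observations. -/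
def Q₂ {Ω : Type*} (X : ℕ → Ω → ℝ) (n : ℕ) (ω : Ω) : ℝ :=
  n * QuadPair.invQuadForm cov₂ (fun i => Z₂Bar X n ω i - C)

end Benford

end

/-! Convergence of the pair of forms is the continuous mapping theorem; the content of the general
result is the Laplace transform. For a centered Gaussian vector `x` with covariance `S` and `M`
positive semidefinite, E exp(-½ xᵀMx) = det(1 + SM)^(-1/2), by diagonalizing and multiplying scalar
integrals (`integral_exp_neg_quadForm_multivariateGaussian`). Take `M` block diagonal with blocks
2t₁Ψ₁⁻¹ and 2t₂Ψ₂⁻¹. Standardizing both blocks replaces `Ψ` by a matrix with identity diagonal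
blocks and off-diagonal block B = Ψ₁^(-1/2) Ψ₁₂ Ψ₂^(-1/2). A Schur complement then reduces the
determinant to that of a combination of 1 and BᵀB, hence to a product over the singular values of B
(`det_one_add_mul_weightedInv`).

For Benford variables, the two statistics are exactly the two quadratic forms evaluated at the
normalized sum of the vectors Z(X_k) (`statistics_eq_quadPair`). The multivariate central limit
theorem, obtained from the scalar one through characteristic functions, gives the Gaussian limit.
What remains is to compute the moments of Z and to show that `covZ` is nonsingular (`isUnit_covZ`),
which rests on a strict inequality in each digit cell (`C_lt_p_mul`). -/

/-! ### Laplace transforms of Gaussian quadratic forms. -/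

open Module in
/-- The determinant of an affine function of a symmetric operator, in terms of eigenvalues. -/
lemma LinearMap.IsSymmetric.det_smul_add_smul {E : Type*} [NormedAddCommGroup E]
    [InnerProductSpace ℝ E] [FiniteDimensional ℝ E] {T : E →ₗ[ℝ] E} (hT : T.IsSymmetric)
    {n : ℕ} (hn : finrank ℝ E = n) (c d : ℝ) :
    LinearMap.det (c • LinearMap.id + d • T) = ∏ i, (c + d * hT.eigenvalues hn i) := by
  have h : LinearMap.toMatrix (hT.eigenvectorBasis hn).toBasis (hT.eigenvectorBasis hn).toBasis
      (c • LinearMap.id + d • T) = Matrix.diagonal fun i => c + d * hT.eigenvalues hn i := by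
    ext i j
    rw [LinearMap.toMatrix_apply]
    simp only [OrthonormalBasis.coe_toBasis, LinearMap.add_apply, LinearMap.smul_apply,
      LinearMap.id_apply, hT.apply_eigenvectorBasis, map_add, map_smul]
    by_cases hij : i = j <;> simp [hij, Matrix.diagonal]
  rw [← LinearMap.det_toMatrix (hT.eigenvectorBasis hn).toBasis, h, Matrix.det_diagonal]

lemma integral_exp_neg_sq_gaussianReal {l : ℝ} (hl : 0 ≤ l) :
    ∫ x, Real.exp (-(1 / 2) * (l * x ^ 2)) ∂(gaussianReal 0 1) = (1 + l) ^ (-(1 / 2 : ℝ)) := by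
  rw [integral_gaussianReal_eq_integral_smul (by simp)]
  have h : ∀ x : ℝ, gaussianPDFReal 0 1 x • Real.exp (-(1 / 2) * (l * x ^ 2)) =
      (√(2 * Real.pi))⁻¹ * Real.exp (-((1 + l) / 2) * x ^ 2) := fun x => by
    simp only [gaussianPDFReal, smul_eq_mul, NNReal.coe_one, mul_one, sub_zero]
    rw [mul_assoc, ← Real.exp_add]
    ring_nf
  simp_rw [h]
  rw [integral_const_mul, integral_gaussian, Real.rpow_neg (by linarith), ← Real.sqrt_eq_rpow,
    ← Real.sqrt_inv, ← Real.sqrt_inv, ← Real.sqrt_mul (by positivity)]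
  congr 1
  have := Real.pi_pos
  field_simp

open Module in
/-- The Laplace transform of a nonnegative quadratic form in a standard Gaussian vector. -/
lemma integral_exp_neg_inner_stdGaussian {E : Type*} [NormedAddCommGroup E]
    [InnerProductSpace ℝ E] [FiniteDimensional ℝ E] [MeasurableSpace E] [BorelSpace E]
    {T : E →ₗ[ℝ] E} (hT : T.IsPositive) :
    ∫ x, Real.exp (-(1 / 2) * inner ℝ x (T x)) ∂(stdGaussian E) =
      (LinearMap.det (LinearMap.id + T)) ^ (-(1 / 2 : ℝ)) := by
  have hS := hT.isSymmetric
  have hnn := hT.nonneg_eigenvalues rfl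
  have hdet := hS.det_smul_add_smul rfl 1 1
  rw [one_smul, one_smul] at hdet
  -- In an eigenbasis of `T` the coordinates of a standard Gaussian vector are still independent
  -- standard normals, so the integral factors over the eigenvalues.
  rw [hdet, stdGaussian_eq_map_pi_orthonormalBasis (hS.eigenvectorBasis rfl),
    integral_map (Measurable.aemeasurable (by fun_prop)) (by
      have : Continuous T := T.continuous_of_finiteDimensional
      fun_prop)]
  have h : ∀ y : Fin (finrank ℝ E) → ℝ,
      inner ℝ (∑ i, y i • hS.eigenvectorBasis rfl i) (T (∑ i, y i • hS.eigenvectorBasis rfl i)) =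
        ∑ i, hS.eigenvalues rfl i * y i ^ 2 := fun y => by
    simp only [map_sum, map_smul, hS.apply_eigenvectorBasis, sum_inner, inner_sum, inner_smul_left,
      inner_smul_right, OrthonormalBasis.inner_eq_ite]
    simp
    exact Finset.sum_congr rfl fun i _ => by ring
  simp_rw [h, Finset.mul_sum, Real.exp_sum]
  rw [integral_fintype_prod_eq_prod
    (f := fun i x => Real.exp (-(1 / 2) * (hS.eigenvalues rfl i * x ^ 2))),
    ← Real.finsetProd_rpow _ _ fun i _ => by have := hnn i; linarith]
  exact Finset.prod_congr rfl fun i _ => by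
    rw [integral_exp_neg_sq_gaussianReal (hnn i), one_mul]

/-- The Laplace transform of a nonnegative quadratic form in a centered Gaussian vector. -/
lemma integral_exp_neg_quadForm_multivariateGaussian {ι : Type*} [Fintype ι] [DecidableEq ι]
    {S M : Matrix ι ι ℝ} (hS : S.PosSemidef) (hM : M.PosSemidef) :
    ∫ x : EuclideanSpace ℝ ι, Real.exp (-(1 / 2) * (x.ofLp ⬝ᵥ M *ᵥ x.ofLp))
      ∂(multivariateGaussian 0 S) = (1 + S * M).det ^ (-(1 / 2 : ℝ)) := by
  set R := CFC.sqrt S with hR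
  have hRR : R * R = S := CFC.sqrt_mul_sqrt_self _ hS.nonneg
  have hRh : Rᴴ = R := (CFC.sqrt_nonneg S).isSelfAdjoint
  have hRt : Rᵀ = R := by rw [← hRh, Matrix.conjTranspose_eq_transpose_of_trivial,
    Matrix.transpose_transpose, ← Matrix.conjTranspose_eq_transpose_of_trivial, hRh]
  have hpos : (R * M * R).PosSemidef := by
    have := hM.conjTranspose_mul_mul_same R
    rwa [hRh] at this
  have hT : (Matrix.toEuclideanLin (R * M * R)).IsPositive :=
    Matrix.isPositive_toEuclideanLin_iff.2 hpos
  rw [multivariateGaussian, integral_map (by fun_prop) (by fun_prop)]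
  have key : ∀ x : EuclideanSpace ℝ ι,
      ((0 : EuclideanSpace ℝ ι) + Matrix.toEuclideanCLM (𝕜 := ℝ) R x).ofLp ⬝ᵥ
        M *ᵥ ((0 : EuclideanSpace ℝ ι) + Matrix.toEuclideanCLM (𝕜 := ℝ) R x).ofLp =
      inner ℝ x (Matrix.toEuclideanLin (R * M * R) x) := fun x => by
    rw [zero_add, Matrix.ofLp_toEuclideanCLM, EuclideanSpace.inner_eq_star_dotProduct,
      Matrix.ofLp_toLpLin, Matrix.toLin'_apply]
    simp only [star_trivial]
    rw [← Matrix.mulVec_mulVec, ← Matrix.mulVec_mulVec, dotProduct_comm, Matrix.dotProduct_mulVec,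
      ← Matrix.mulVec_transpose, hRt]
  simp_rw [← hR, key]
  rw [integral_exp_neg_inner_stdGaussian hT]
  congr 1
  have h1 : LinearMap.id + Matrix.toEuclideanLin (R * M * R) =
      Matrix.toEuclideanLin (1 + R * (M * R)) := by
    rw [map_add, Matrix.mul_assoc]
    congr 1
    ext x : 1
    simp [Matrix.toEuclideanLin]
  -- Two uses of det(1 + AB) = det(1 + BA) move both square roots to the same side, where they
  -- recombine to `S`.
  rw [h1, Matrix.toEuclideanLin_eq_toLin_orthonormal, LinearMap.det_toLin,
    Matrix.det_one_add_mul_comm, Matrix.mul_assoc, hRR, Matrix.det_one_add_mul_comm]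

/-! ### Standardized blocks and canonical correlations. -/

namespace QuadPair

variable {r₁ r₂ : ℕ} {Ψ : Matrix (Fin r₁ ⊕ Fin r₂) (Fin r₁ ⊕ Fin r₂) ℝ}

lemma posDef_toBlocks₁₁ (hΨ : Ψ.PosDef) : Ψ.toBlocks₁₁.PosDef :=
  hΨ.submatrix Sum.inl_injective

lemma posDef_toBlocks₂₂ (hΨ : Ψ.PosDef) : Ψ.toBlocks₂₂.PosDef :=
  hΨ.submatrix Sum.inr_injective

/-- The matrix `Ψ₁^(-1/2) Ψ₁₂ Ψ₂^(-1/2)` of correlations between the standardized blocks. -/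
noncomputable def corrMatrix (Ψ : Matrix (Fin r₁ ⊕ Fin r₂) (Fin r₁ ⊕ Fin r₂) ℝ) :
    Matrix (Fin r₁) (Fin r₂) ℝ :=
  (CFC.sqrt Ψ.toBlocks₁₁)⁻¹ * Ψ.toBlocks₁₂ * (CFC.sqrt Ψ.toBlocks₂₂)⁻¹

/-- The block diagonal matrix with blocks `Ψ₁^(1/2)` and `Ψ₂^(1/2)`. -/
noncomputable def sqrtBlocks (Ψ : Matrix (Fin r₁ ⊕ Fin r₂) (Fin r₁ ⊕ Fin r₂) ℝ) :
    Matrix (Fin r₁ ⊕ Fin r₂) (Fin r₁ ⊕ Fin r₂) ℝ :=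
  Matrix.fromBlocks (CFC.sqrt Ψ.toBlocks₁₁) 0 0 (CFC.sqrt Ψ.toBlocks₂₂)

lemma isUnit_det_sqrt {n : Type*} [Fintype n] [DecidableEq n] {A : Matrix n n ℝ} (hA : A.PosDef) :
    IsUnit (CFC.sqrt A).det :=
  (Matrix.isUnit_iff_isUnit_det _).1
    ((CFC.isUnit_sqrt_iff A hA.posSemidef.nonneg).2 hA.isUnit)

lemma transpose_sqrt {n : Type*} [Fintype n] [DecidableEq n] (A : Matrix n n ℝ) :
    (CFC.sqrt A)ᵀ = CFC.sqrt A := by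
  rw [← Matrix.conjTranspose_eq_transpose_of_trivial]
  exact (CFC.sqrt_nonneg A).isSelfAdjoint

lemma inv_sqrt_mul_inv_sqrt {n : Type*} [Fintype n] [DecidableEq n] {A : Matrix n n ℝ}
    (hA : A.PosDef) : (CFC.sqrt A)⁻¹ * (CFC.sqrt A)⁻¹ = A⁻¹ := by
  rw [← Matrix.mul_inv_rev, CFC.sqrt_mul_sqrt_self _ hA.posSemidef.nonneg]

lemma isUnit_det_sqrtBlocks (hΨ : Ψ.PosDef) : IsUnit (sqrtBlocks Ψ).det := by
  rw [sqrtBlocks, Matrix.det_fromBlocks_zero₂₁]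
  exact (isUnit_det_sqrt (posDef_toBlocks₁₁ hΨ)).mul (isUnit_det_sqrt (posDef_toBlocks₂₂ hΨ))

lemma toBlocks₂₁_eq_transpose (hΨ : Ψ.PosDef) : Ψ.toBlocks₂₁ = Ψ.toBlocks₁₂ᵀ := by
  ext i j
  simpa [Matrix.toBlocks₂₁, Matrix.toBlocks₁₂] using (hΨ.isHermitian.apply (Sum.inr i) (Sum.inl j)).symm

/-- A positive definite matrix in terms of the correlations of the standardized blocks. -/
lemma sqrtBlocks_mul_mul_sqrtBlocks (hΨ : Ψ.PosDef) :
    sqrtBlocks Ψ * Matrix.fromBlocks 1 (corrMatrix Ψ) (corrMatrix Ψ)ᵀ 1 * sqrtBlocks Ψ = Ψ := by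
  have u₁ := isUnit_det_sqrt (posDef_toBlocks₁₁ hΨ)
  have u₂ := isUnit_det_sqrt (posDef_toBlocks₂₂ hΨ)
  have s₁ := CFC.sqrt_mul_sqrt_self _ (posDef_toBlocks₁₁ hΨ).posSemidef.nonneg
  have s₂ := CFC.sqrt_mul_sqrt_self _ (posDef_toBlocks₂₂ hΨ).posSemidef.nonneg
  have e₁₂ : CFC.sqrt Ψ.toBlocks₁₁ * corrMatrix Ψ * CFC.sqrt Ψ.toBlocks₂₂ = Ψ.toBlocks₁₂ := by
    rw [corrMatrix, Matrix.mul_assoc, Matrix.mul_assoc, Matrix.nonsing_inv_mul _ u₂, Matrix.mul_one,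
      Matrix.mul_nonsing_inv_cancel_left _ _ u₁]
  have e₂₁ : CFC.sqrt Ψ.toBlocks₂₂ * (corrMatrix Ψ)ᵀ * CFC.sqrt Ψ.toBlocks₁₁ = Ψ.toBlocks₂₁ := by
    rw [toBlocks₂₁_eq_transpose hΨ, ← e₁₂, Matrix.transpose_mul, Matrix.transpose_mul,
      transpose_sqrt, transpose_sqrt, Matrix.mul_assoc]
  rw [sqrtBlocks, Matrix.fromBlocks_multiply, Matrix.fromBlocks_multiply]
  simp only [Matrix.mul_one, Matrix.mul_zero, Matrix.zero_mul, add_zero, zero_add, s₁, s₂, e₁₂, e₂₁,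
    Matrix.fromBlocks_toBlocks]

/-- Congruence by the invertible `sqrtBlocks Ψ` carries positivity of `Ψ` to the matrix with blocks
1, B, Bᵀ, 1, and the Schur complement of its first block is 1 - BᵀB. -/
lemma posSemidef_one_sub_corrMatrix (hΨ : Ψ.PosDef) :
    (1 - (corrMatrix Ψ)ᵀ * corrMatrix Ψ).PosSemidef := by
  have hu : IsUnit (sqrtBlocks Ψ) := (Matrix.isUnit_iff_isUnit_det _).2 (isUnit_det_sqrtBlocks hΨ)
  have hs : star (sqrtBlocks Ψ) = sqrtBlocks Ψ := by
    rw [Matrix.star_eq_conjTranspose, Matrix.conjTranspose_eq_transpose_of_trivial, sqrtBlocks,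
      Matrix.fromBlocks_transpose, transpose_sqrt, transpose_sqrt]
    simp
  have h := hΨ.posSemidef
  rw [← sqrtBlocks_mul_mul_sqrtBlocks hΨ] at h
  nth_rw 1 [← hs] at h
  rw [Matrix.IsUnit.posSemidef_star_left_conjugate_iff hu,
    ← Matrix.conjTranspose_eq_transpose_of_trivial] at h
  let _ : Invertible (1 : Matrix (Fin r₁) (Fin r₁) ℝ) := invertibleOne
  rw [Matrix.PosDef.fromBlocks₁₁ _ _ Matrix.PosDef.one] at h
  simpa using h

lemma canonCorr_nonneg (Ψ : Matrix (Fin r₁ ⊕ Fin r₂) (Fin r₁ ⊕ Fin r₂) ℝ) (j : ℕ) :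
    0 ≤ canonCorr Ψ j :=
  LinearMap.singularValues_nonneg _ j

lemma antitone_canonCorr (Ψ : Matrix (Fin r₁ ⊕ Fin r₂) (Fin r₁ ⊕ Fin r₂) ℝ) :
    Antitone (canonCorr Ψ) :=
  LinearMap.singularValues_antitone _

/-- The rank of the correlation matrix is at most the dimension `r₁` of its target. -/
lemma canonCorr_of_le {j : ℕ} (hj : r₁ ≤ j) : canonCorr Ψ j = 0 := by
  rw [canonCorr, LinearMap.singularValues_eq_zero_iff_le_finrank_range]
  refine (Submodule.finrank_le _).trans ?_
  simpa using hj

lemma adjoint_comp_self_toEuclideanLin {m n : Type*} [Fintype m] [Fintype n] [DecidableEq n]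
    [DecidableEq m] (B : Matrix m n ℝ) :
    (Matrix.toEuclideanLin B).adjoint ∘ₗ Matrix.toEuclideanLin B =
      Matrix.toEuclideanLin (Bᵀ * B) := by
  rw [← Matrix.toEuclideanLin_conjTranspose_eq_adjoint,
    Matrix.conjTranspose_eq_transpose_of_trivial]
  ext x : 1
  simp [Matrix.toEuclideanLin]

/-- Let v be an eigenvector of BᵀB for the eigenvalue σ². Testing 1 - BᵀB ≥ 0 on v gives (1 -
σ²)|v|² ≥ 0. Indices from `r₂` on carry the default singular value 0. -/
lemma canonCorr_le_one (hΨ : Ψ.PosDef) (j : ℕ) : canonCorr Ψ j ≤ 1 := by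
  rcases lt_or_ge j r₂ with hj | hj
  · have hj' : j < Module.finrank ℝ (EuclideanSpace ℝ (Fin r₂)) := by simpa using hj
    have he := LinearMap.hasEigenvalue_adjoint_comp_self_sq_singularValues
      (Matrix.toEuclideanLin (corrMatrix Ψ)) hj'
    obtain ⟨v, hv⟩ := he.exists_hasEigenvector
    rw [adjoint_comp_self_toEuclideanLin] at hv
    have hv1 := congrArg WithLp.ofLp hv.apply_eq_smul
    rw [Matrix.ofLp_toLpLin, Matrix.toLin'_apply] at hv1
    have h := (posSemidef_one_sub_corrMatrix hΨ).dotProduct_mulVec_nonneg v.ofLp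
    rw [Matrix.sub_mulVec, hv1] at h
    simp only [star_trivial, Matrix.one_mulVec, WithLp.ofLp_smul, dotProduct_sub,
      dotProduct_smul, smul_eq_mul] at h
    have hvpos : 0 < v.ofLp ⬝ᵥ v.ofLp := by
      have : v.ofLp ≠ 0 := fun h0 => hv.2 (by ext i; simp [h0])
      simpa using Matrix.dotProduct_star_self_pos_iff.2 this
    have hsq : canonCorr Ψ j ^ 2 ≤ 1 := by
      by_contra hc
      push Not at hc
      have : (canonCorr Ψ j ^ 2 - 1) * (v.ofLp ⬝ᵥ v.ofLp) > 0 := mul_pos (by linarith) hvpos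
      have h' : 0 ≤ v.ofLp ⬝ᵥ v.ofLp - canonCorr Ψ j ^ 2 * (v.ofLp ⬝ᵥ v.ofLp) := h
      linarith
    exact (sq_le_one_iff₀ (canonCorr_nonneg Ψ j)).1 hsq
  · rw [canonCorr, LinearMap.singularValues_of_finrank_le _ (by simpa using hj)]
    exact zero_le_one

/-- The eigenvalues of BᵀB are the squared singular values of B; the product has `r₂` factors
because BᵀB acts on the second block. -/
lemma det_smul_one_sub_corrMatrix (Ψ : Matrix (Fin r₁ ⊕ Fin r₂) (Fin r₁ ⊕ Fin r₂) ℝ) (c d : ℝ) :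
    (c • 1 - d • ((corrMatrix Ψ)ᵀ * corrMatrix Ψ)).det =
      ∏ j ∈ Finset.range r₂, (c - d * canonCorr Ψ j ^ 2) := by
  set T := Matrix.toEuclideanLin (corrMatrix Ψ)
  have hn : Module.finrank ℝ (EuclideanSpace ℝ (Fin r₂)) = r₂ := by simp
  have h := T.isSymmetric_adjoint_comp_self.det_smul_add_smul hn c (-d)
  have h1 : c • LinearMap.id + (-d) • (T.adjoint ∘ₗ T) =
      Matrix.toEuclideanLin (c • 1 - d • ((corrMatrix Ψ)ᵀ * corrMatrix Ψ)) := by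
    rw [adjoint_comp_self_toEuclideanLin, map_sub, map_smul, map_smul, neg_smul, sub_eq_add_neg]
    congr 2
    ext x : 1
    simp [Matrix.toEuclideanLin]
  rw [h1, Matrix.toEuclideanLin_eq_toLin_orthonormal, LinearMap.det_toLin] at h
  rw [h, Finset.prod_range]
  refine Finset.prod_congr rfl fun i _ => ?_
  rw [← T.sq_singularValues_fin hn i]
  simp only [neg_mul, ← sub_eq_add_neg]
  rfl

end QuadPair

/-! ### The Laplace transform of the pair of quadratic forms. -/

namespace QuadPair

variable {r₁ r₂ : ℕ} {Ψ : Matrix (Fin r₁ ⊕ Fin r₂) (Fin r₁ ⊕ Fin r₂) ℝ}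

/-- The matrix of the quadratic form `2 (t₁ y₁ᵀ Ψ₁⁻¹ y₁ + t₂ y₂ᵀ Ψ₂⁻¹ y₂)`. -/
noncomputable def weightedInv (Ψ : Matrix (Fin r₁ ⊕ Fin r₂) (Fin r₁ ⊕ Fin r₂) ℝ) (t₁ t₂ : ℝ) :
    Matrix (Fin r₁ ⊕ Fin r₂) (Fin r₁ ⊕ Fin r₂) ℝ :=
  Matrix.fromBlocks ((2 * t₁) • Ψ.toBlocks₁₁⁻¹) 0 0 ((2 * t₂) • Ψ.toBlocks₂₂⁻¹)

lemma dotProduct_weightedInv_mulVec (y : EuclideanSpace ℝ (Fin r₁ ⊕ Fin r₂)) (t₁ t₂ : ℝ) :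
    -(1 / 2) * (y.ofLp ⬝ᵥ weightedInv Ψ t₁ t₂ *ᵥ y.ofLp) =
      -t₁ * (quadPair Ψ y).1 - t₂ * (quadPair Ψ y).2 := by
  have hy : y.ofLp = Sum.elim (fstBlock y) (sndBlock y) := by
    ext (i | i) <;> rfl
  rw [hy, weightedInv, Matrix.fromBlocks_mulVec, sumElim_dotProduct_sumElim]
  simp only [Sum.elim_comp_inl, Sum.elim_comp_inr, Matrix.zero_mulVec, add_zero, zero_add,
    Matrix.smul_mulVec, dotProduct_smul, smul_eq_mul, quadPair, invQuadForm]
  ring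

lemma weightedInv_eq (hΨ : Ψ.PosDef) (t₁ t₂ : ℝ) :
    weightedInv Ψ t₁ t₂ =
      (sqrtBlocks Ψ)⁻¹ * Matrix.fromBlocks ((2 * t₁) • 1) 0 0 ((2 * t₂) • 1) * (sqrtBlocks Ψ)⁻¹ := by
  have u₁ := isUnit_det_sqrt (posDef_toBlocks₁₁ hΨ)
  have u₂ := isUnit_det_sqrt (posDef_toBlocks₂₂ hΨ)
  have hinv : (sqrtBlocks Ψ)⁻¹ =
      Matrix.fromBlocks (CFC.sqrt Ψ.toBlocks₁₁)⁻¹ 0 0 (CFC.sqrt Ψ.toBlocks₂₂)⁻¹ := by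
    refine Matrix.inv_eq_right_inv ?_
    rw [sqrtBlocks, Matrix.fromBlocks_multiply]
    simp [Matrix.mul_nonsing_inv _ u₁, Matrix.mul_nonsing_inv _ u₂]
  rw [hinv, Matrix.fromBlocks_multiply, Matrix.fromBlocks_multiply, weightedInv]
  simp [inv_sqrt_mul_inv_sqrt (posDef_toBlocks₁₁ hΨ), inv_sqrt_mul_inv_sqrt (posDef_toBlocks₂₂ hΨ)]

lemma posSemidef_weightedInv (hΨ : Ψ.PosDef) {t₁ t₂ : ℝ} (h₁ : 0 ≤ t₁) (h₂ : 0 ≤ t₂) :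
    (weightedInv Ψ t₁ t₂).PosSemidef := by
  have hd : (Matrix.fromBlocks ((2 * t₁) • (1 : Matrix (Fin r₁) (Fin r₁) ℝ)) 0 0
      ((2 * t₂) • (1 : Matrix (Fin r₂) (Fin r₂) ℝ))).PosSemidef := by
    rw [← Matrix.diagonal_one, ← Matrix.diagonal_one, Matrix.smul_eq_diagonal_mul,
      Matrix.smul_eq_diagonal_mul, Matrix.diagonal_mul_diagonal, Matrix.diagonal_mul_diagonal,
      Matrix.fromBlocks_diagonal, Matrix.posSemidef_diagonal_iff]
    rintro (i | i) <;> simp [h₁, h₂]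
  have hs : ((sqrtBlocks Ψ)⁻¹)ᴴ = (sqrtBlocks Ψ)⁻¹ := by
    rw [Matrix.conjTranspose_eq_transpose_of_trivial, Matrix.transpose_nonsing_inv, sqrtBlocks,
      Matrix.fromBlocks_transpose, transpose_sqrt, transpose_sqrt]
    simp
  have := hd.conjTranspose_mul_mul_same (sqrtBlocks Ψ)⁻¹
  rwa [hs, ← weightedInv_eq hΨ] at this

/-- Conjugation by `sqrtBlocks Ψ` leaves det(1 + ND), where N has blocks 1, B, Bᵀ, 1 and D is block
scalar. Its upper left block is (1 + 2t₁) times the identity, invertible since t₁ ≥ 0, so the Schur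
complement formula applies. -/
lemma det_one_add_mul_weightedInv (hΨ : Ψ.PosDef) (hr : r₁ ≤ r₂) {t₁ : ℝ} (h₁ : 0 ≤ t₁)
    (t₂ : ℝ) :
    (1 + Ψ * weightedInv Ψ t₁ t₂).det = (1 + 2 * t₂) ^ (r₂ - r₁) *
      ∏ j ∈ Finset.range r₁,
        (1 + 2 * t₁ + 2 * t₂ + 4 * (1 - canonCorr Ψ j ^ 2) * t₁ * t₂) := by
  set B := corrMatrix Ψ with hB
  set N := Matrix.fromBlocks 1 B Bᵀ 1 with hN
  set D : Matrix (Fin r₁ ⊕ Fin r₂) (Fin r₁ ⊕ Fin r₂) ℝ :=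
    Matrix.fromBlocks ((2 * t₁) • 1) 0 0 ((2 * t₂) • 1) with hD
  have hu := isUnit_det_sqrtBlocks hΨ
  have hne : (1 + 2 * t₁) ≠ 0 := by positivity
  have e1 : (1 + Ψ * weightedInv Ψ t₁ t₂).det = (1 + N * D).det := by
    rw [weightedInv_eq hΨ, ← hD]
    nth_rw 1 [← sqrtBlocks_mul_mul_sqrtBlocks hΨ]
    rw [← hB, ← hN, show sqrtBlocks Ψ * N * sqrtBlocks Ψ *
        ((sqrtBlocks Ψ)⁻¹ * D * (sqrtBlocks Ψ)⁻¹) = sqrtBlocks Ψ * (N * D * (sqrtBlocks Ψ)⁻¹) by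
      rw [Matrix.mul_assoc _ D, Matrix.mul_assoc _ (sqrtBlocks Ψ),
        Matrix.mul_nonsing_inv_cancel_left _ _ hu]
      simp only [Matrix.mul_assoc]]
    rw [Matrix.det_one_add_mul_comm, Matrix.mul_assoc, Matrix.nonsing_inv_mul _ hu, Matrix.mul_one]
  have e2 : 1 + N * D = Matrix.fromBlocks ((1 + 2 * t₁) • 1) ((2 * t₂) • B) ((2 * t₁) • Bᵀ)
      ((1 + 2 * t₂) • 1) := by
    rw [hN, hD, Matrix.fromBlocks_multiply, ← Matrix.fromBlocks_one, Matrix.fromBlocks_add]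
    simp [add_smul]
  let _ : Invertible ((1 + 2 * t₁) • (1 : Matrix (Fin r₁) (Fin r₁) ℝ)) :=
    ⟨(1 + 2 * t₁)⁻¹ • 1, by simp [smul_smul, hne], by simp [smul_smul, hne]⟩
  have e3 : ⅟((1 + 2 * t₁) • (1 : Matrix (Fin r₁) (Fin r₁) ℝ)) = (1 + 2 * t₁)⁻¹ • 1 := rfl
  rw [e1, e2, Matrix.det_fromBlocks₁₁, e3]
  have e4 : (1 + 2 * t₂) • (1 : Matrix (Fin r₂) (Fin r₂) ℝ) -
      ((2 * t₁) • Bᵀ) * ((1 + 2 * t₁)⁻¹ • (1 : Matrix (Fin r₁) (Fin r₁) ℝ)) * ((2 * t₂) • B) =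
      (1 + 2 * t₂) • 1 - (4 * t₁ * t₂ / (1 + 2 * t₁)) • (Bᵀ * B) := by
    simp only [Matrix.smul_mul, Matrix.mul_smul, Matrix.mul_one, smul_smul]
    congr 2
    field_simp
    ring
  rw [e4, hB, det_smul_one_sub_corrMatrix, Matrix.det_smul, Matrix.det_one, mul_one,
    Fintype.card_fin, ← Finset.prod_range_mul_prod_Ico _ hr]
  -- The `r₂ - r₁` surplus singular values vanish; this is the source of the separate power of 1 +
  -- 2t₂.
  have e5 : ∏ j ∈ Finset.Ico r₁ r₂,
      (1 + 2 * t₂ - 4 * t₁ * t₂ / (1 + 2 * t₁) * canonCorr Ψ j ^ 2) = (1 + 2 * t₂) ^ (r₂ - r₁) := by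
    rw [Finset.prod_congr rfl (g := fun _ => 1 + 2 * t₂) fun j hj => ?_]
    · simp
    · rw [canonCorr_of_le (Finset.mem_Ico.1 hj).1]
      ring
  -- The determinant (1 + 2t₁)^r₁ of the first block is spread over the remaining `r₁` factors,
  -- clearing their denominators.
  rw [e5, ← mul_assoc, mul_comm, show (1 + 2 * t₁) ^ r₁ = ∏ _j ∈ Finset.range r₁, (1 + 2 * t₁) by simp,
    ← Finset.prod_mul_distrib]
  congr 1
  refine Finset.prod_congr rfl fun j _ => ?_
  field_simp
  ring

/-- The Laplace transform of the pair of normalized quadratic forms in a Gaussian vector. -/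
theorem laplace_quadPair {Ω : Type*} [MeasurableSpace Ω] {P : Measure Ω}
    (hΨ : Ψ.PosDef) (hr : r₁ ≤ r₂) {Y : Ω → EuclideanSpace ℝ (Fin r₁ ⊕ Fin r₂)}
    (hY : HasLaw Y (multivariateGaussian 0 Ψ) P) {t₁ t₂ : ℝ} (h₁ : 0 ≤ t₁) (h₂ : 0 ≤ t₂) :
    laplace P (fun ω => quadPair Ψ (Y ω)) t₁ t₂ =
      (1 + 2 * t₂) ^ (-(1 / 2 : ℝ) * ((r₂ : ℝ) - r₁)) *
        ∏ j ∈ Finset.range r₁,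
          (1 + 2 * t₁ + 2 * t₂ + 4 * (1 - canonCorr Ψ j ^ 2) * t₁ * t₂) ^ (-(1 / 2 : ℝ)) := by
  -- Nonnegativity of each factor, which uses that the correlations are at most 1, lets the real
  -- power -1/2 pass through the product.
  have hfac : ∀ j ∈ Finset.range r₁,
      0 ≤ 1 + 2 * t₁ + 2 * t₂ + 4 * (1 - canonCorr Ψ j ^ 2) * t₁ * t₂ := fun j _ => by
    have : 0 ≤ 1 - canonCorr Ψ j ^ 2 := by
      have := pow_le_one₀ (n := 2) (canonCorr_nonneg Ψ j) (canonCorr_le_one hΨ j)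
      linarith
    positivity
  have h := integral_exp_neg_quadForm_multivariateGaussian hΨ.posSemidef
    (posSemidef_weightedInv hΨ h₁ h₂)
  rw [← hY.integral_comp (Continuous.aestronglyMeasurable (by fun_prop))] at h
  simp only [Function.comp_def, dotProduct_weightedInv_mulVec] at h
  rw [laplace, h, det_one_add_mul_weightedInv hΨ hr h₁ t₂,
    Real.mul_rpow (by positivity) (Finset.prod_nonneg hfac), Real.finsetProd_rpow _ _ hfac,
    ← Real.rpow_natCast, ← Real.rpow_mul (by positivity), Nat.cast_sub hr, mul_comm (-(1 / 2 : ℝ))]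

lemma continuous_quadPair (Ψ : Matrix (Fin r₁ ⊕ Fin r₂) (Fin r₁ ⊕ Fin r₂) ℝ) :
    Continuous (quadPair Ψ) := by
  unfold quadPair invQuadForm fstBlock sndBlock
  fun_prop

end QuadPair

/-! ### Covariance matrices and the multivariate central limit theorem. -/

/-- A covariance matrix is positive semidefinite. -/
lemma posSemidef_of_covariance {Ω ι : Type*} [MeasurableSpace Ω] [Fintype ι] {P : Measure Ω}
    [IsProbabilityMeasure P] {Y : Ω → ι → ℝ} {S : Matrix ι ι ℝ}
    (hY : ∀ i, MemLp (fun ω => Y ω i) 2 P)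
    (hS : ∀ i j, cov[fun ω => Y ω i, fun ω => Y ω j; P] = S i j) : S.PosSemidef := by
  refine .of_dotProduct_mulVec_nonneg (.ext fun i j => ?_) fun x => ?_
  · rw [star_trivial, ← hS, ← hS, covariance_comm]
  · have h := variance_fun_sum (μ := P) (X := fun i ω => x i * Y ω i) fun i => (hY i).const_mul (x i)
    have h0 := variance_nonneg (fun ω => ∑ i, x i * Y ω i) P
    rw [h] at h0
    have hc : ∀ i j, cov[fun ω => x i * Y ω i, fun ω => x j * Y ω j; P] = x i * (x j * S i j) :=
      fun i j => by rw [covariance_const_mul_left, covariance_const_mul_right, hS]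
    simp only [hc] at h0
    refine h0.trans_eq ?_
    simp only [star_trivial, dotProduct, Matrix.mulVec, Finset.mul_sum]
    exact Finset.sum_congr rfl fun i _ => Finset.sum_congr rfl fun j _ => by ring

/-- A positive semidefinite real matrix of full rank is positive definite. -/
lemma Matrix.PosSemidef.posDef_of_rank_eq_card {ι : Type*} [Fintype ι] [DecidableEq ι]
    {S : Matrix ι ι ℝ} (hS : S.PosSemidef) (h : S.rank = Fintype.card ι) : S.PosDef := by
  rw [hS.posDef_iff_isUnit, ← Matrix.linearIndependent_cols_iff_isUnit,
    linearIndependent_iff_card_eq_finrank_span, ← h, Matrix.rank_eq_finrank_span_cols]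
  rfl

/-- The Cramér–Wold device: the characteristic function at `t` sees only the scalar projection along
`t`. -/
lemma charFun_map_eq_charFun_map_inner {Ω E : Type*} [MeasurableSpace Ω] {P : Measure Ω}
    [NormedAddCommGroup E] [InnerProductSpace ℝ E] [MeasurableSpace E] [BorelSpace E]
    [SecondCountableTopology E] {f : Ω → E} (hf : AEMeasurable f P) (t : E) :
    charFun (P.map f) t = charFun (P.map fun ω => inner ℝ (f ω) t) 1 := by
  rw [charFun_apply, charFun_apply_real, integral_map hf (by fun_prop),
    integral_map (by fun_prop) (by fun_prop)]
  simp

/-- The **central limit theorem** in finite dimension. -/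
theorem tendstoInDistribution_inv_sqrt_smul_sum_sub {Ω Ω' ι : Type*} [MeasurableSpace Ω]
    [MeasurableSpace Ω'] [Fintype ι] [DecidableEq ι] {P : Measure Ω} [IsProbabilityMeasure P]
    {P' : Measure Ω'} [IsProbabilityMeasure P'] {X : ℕ → Ω → EuclideanSpace ℝ ι}
    {Y : Ω' → EuclideanSpace ℝ ι} {m : EuclideanSpace ℝ ι} {S : Matrix ι ι ℝ}
    (hY : HasLaw Y (multivariateGaussian 0 S) P') (hX : ∀ i, MemLp (fun ω => X 0 ω i) 2 P)
    (hm : ∀ i, ∫ ω, X 0 ω i ∂P = m i)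
    (hS : ∀ i j, cov[fun ω => X 0 ω i, fun ω => X 0 ω j; P] = S i j)
    (hindep : iIndepFun X P) (hident : ∀ k, IdentDistrib (X k) (X 0) P P) :
    TendstoInDistribution (fun (n : ℕ) ω => (√n)⁻¹ • (∑ k ∈ Finset.range n, X k ω - (n : ℝ) • m))
      atTop Y (fun _ => P) P' := by
  have hmeas : ∀ k, AEMeasurable (X k) P := fun k => (hident k).aemeasurable_fst
  have hpsd : S.PosSemidef := posSemidef_of_covariance hX hS
  have hmeas' : ∀ n : ℕ, AEMeasurable
      (fun ω => (√n)⁻¹ • (∑ k ∈ Finset.range n, X k ω - (n : ℝ) • m)) P := fun n =>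
    ((Finset.aemeasurable_fun_sum _ fun k _ => hmeas k).sub_const _).fun_const_smul _
  refine ⟨hmeas', hY.aemeasurable, ProbabilityMeasure.tendsto_iff_tendsto_charFun.2 fun t => ?_⟩
  have hinner : ∀ x : EuclideanSpace ℝ ι, inner ℝ x t = ∑ i, t i * x i := fun x => by
    simp [PiLp.inner_apply]
  have hL : Measurable fun x : EuclideanSpace ℝ ι => inner ℝ x t := by fun_prop
  have hvar : Var[fun ω => inner ℝ (X 0 ω) t; P] = t.ofLp ⬝ᵥ S *ᵥ t.ofLp := by
    simp_rw [hinner]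
    rw [variance_fun_sum (X := fun i ω => t i * X 0 ω i) fun i => (hX i).const_mul (t i)]
    simp only [dotProduct, Matrix.mulVec, Finset.mul_sum]
    refine Finset.sum_congr rfl fun i _ => Finset.sum_congr rfl fun j _ => ?_
    rw [covariance_const_mul_left, covariance_const_mul_right, hS]
    ring
  have hmean : ∫ ω, inner ℝ (X 0 ω) t ∂P = inner ℝ m t := by
    simp_rw [hinner]
    rw [integral_finsetSum _ fun i _ => ((hX i).integrable one_le_two).const_mul _]
    simp_rw [integral_const_mul, hm]
  have hmem : MemLp (fun ω => inner ℝ (X 0 ω) t) 2 P := by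
    simp_rw [hinner]
    exact memLp_finsetSum _ fun i _ => (hX i).const_mul (t i)
  have hclt := tendstoInDistribution_inv_sqrt_mul_sum_sub (P := P)
    (X := fun k ω => inner ℝ (X k ω) t)
    (HasLaw.id (μ := gaussianReal 0 Var[fun ω => inner ℝ (X 0 ω) t; P].toNNReal)) hmem
    (hindep.comp (fun _ x => inner ℝ x t) fun _ => hL) (fun k => (hident k).comp hL)
  -- The argument 1 suffices, because `t` is already absorbed into the projection.
  have hlim := ProbabilityMeasure.tendsto_iff_tendsto_charFun.1 hclt.tendsto 1
  simp only [ProbabilityMeasure.coe_mk, Measure.map_id, charFun_gaussianReal, hvar, hmean] at hlim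
  simp only [ProbabilityMeasure.coe_mk, hY.map_eq, charFun_multivariateGaussian hpsd]
  have hnn : 0 ≤ t.ofLp ⬝ᵥ S *ᵥ t.ofLp := by simpa using hpsd.dotProduct_mulVec_nonneg t.ofLp
  convert hlim using 2 with n
  · rw [charFun_map_eq_charFun_map_inner (hmeas' n)]
    simp only [inner_smul_left, inner_sub_left, sum_inner, RCLike.conj_to_real]
  -- The truncation `toNNReal` of the variance is harmless, since tᵀSt ≥ 0.
  · simp [hnn]

/-! ### Digit probabilities and truncated moments of the significand. -/

namespace Benford

lemma C_eq : C = (Real.log 10)⁻¹ := by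
  simp [C, Real.logb]

lemma log_ten_pos : 0 < Real.log 10 := Real.log_pos (by norm_num)

lemma C_pos : 0 < C := by
  rw [C_eq]
  exact inv_pos.2 log_ten_pos

lemma p_eq_sub {d : ℕ} (hd : 1 ≤ d) :
    p d = Real.logb 10 ((d : ℝ) + 1) - Real.logb 10 d := by
  have : (d : ℝ) ≠ 0 := by positivity
  rw [p, Real.logb_div (by positivity) this]

/-- After multiplication by C this is strict Cauchy–Schwarz on a digit cell: the squared first
moment C² is less than p_d times the second moment C(d + 1/2). It is derived here from log(1 + x) >
2x/(x + 2) at x = 1/d. -/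
lemma C_lt_p_mul {d : ℕ} (hd : 1 ≤ d) : C < p d * ((d : ℝ) + 1 / 2) := by
  have hd0 : (0 : ℝ) < d := by positivity
  have h : 2 * (d : ℝ)⁻¹ / ((d : ℝ)⁻¹ + 2) < Real.log (1 + (d : ℝ)⁻¹) :=
    Real.lt_log_one_add_of_pos (by positivity)
  rw [p, Real.logb, C_eq, show ((d : ℝ) + 1) / d = 1 + (d : ℝ)⁻¹ by field_simp]
  have h2 : 2 * (d : ℝ)⁻¹ / ((d : ℝ)⁻¹ + 2) = ((d : ℝ) + 1 / 2)⁻¹ := by field_simp; ring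
  rw [h2, inv_lt_iff_one_lt_mul₀ (by positivity)] at h
  have := log_ten_pos
  rw [div_mul_eq_mul_div, inv_eq_one_div]
  exact div_lt_div_of_pos_right h this

lemma p_pos {d : ℕ} (hd : 1 ≤ d) : 0 < p d :=
  pos_of_mul_pos_left (C_pos.trans (C_lt_p_mul hd)) (by positivity)

lemma sum_p : ∑ i : Fin 9, p (i.val + 1) = 1 := by
  rw [Fin.sum_univ_eq_sum_range (fun i => p (i + 1)),
    Finset.sum_congr rfl fun i _ => p_eq_sub (Nat.le_add_left 1 i)]
  have := Finset.sum_range_sub (fun i : ℕ => Real.logb 10 ((i : ℝ) + 1)) 9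
  simp only [Nat.cast_add, Nat.cast_one] at this ⊢
  rw [this]
  norm_num

lemma sum_p_castSucc : ∑ i : Fin 8, p (i.val + 1) = 1 - p 9 := by
  have := sum_p
  rw [Fin.sum_univ_castSucc] at this
  simp at this
  linarith

lemma measurable_significand : Measurable significand := by
  unfold significand Real.logb
  fun_prop

lemma one_le_significand (x : ℝ) : 1 ≤ significand x :=
  Real.one_le_rpow (by norm_num) (Int.fract_nonneg _)

lemma significand_lt_ten (x : ℝ) : significand x < 10 := by
  have := Real.rpow_lt_rpow_of_exponent_lt (x := 10) (by norm_num)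
    (Int.fract_lt_one (Real.logb 10 |x|))
  simpa [significand] using this

/-- The restriction of the `m`-th power to the significands with first digit `d`. -/
noncomputable def cellPow (d m : ℕ) : ℝ → ℝ :=
  Set.indicator (Set.Ico (d : ℝ) (d + 1)) (fun s => s ^ m)

lemma measurable_cellPow (d m : ℕ) : Measurable (cellPow d m) :=
  (measurable_id.pow_const m).indicator measurableSet_Ico

lemma rpow_mem_cell_iff {d : ℕ} (hd : 1 ≤ d) (u : ℝ) :
    (10 : ℝ) ^ u ∈ Set.Ico (d : ℝ) (d + 1) ↔
      u ∈ Set.Ico (Real.logb 10 d) (Real.logb 10 ((d : ℝ) + 1)) := by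
  have hd0 : (0 : ℝ) < d := by positivity
  rw [Set.mem_Ico, Set.mem_Ico, Real.logb_le_iff_le_rpow (by norm_num) hd0,
    Real.lt_logb_iff_rpow_lt (by norm_num) (by positivity)]

lemma integral_cellPow {d : ℕ} (hd : 1 ≤ d) (hd9 : d ≤ 9) (m : ℕ) :
    ∫ s, cellPow d m s ∂significandLaw =
      ∫ u in (Real.logb 10 d)..(Real.logb 10 ((d : ℝ) + 1)), ((10 : ℝ) ^ u) ^ m := by
  have hd1 : (1 : ℝ) ≤ d := by exact_mod_cast hd
  have hd9' : (d : ℝ) ≤ 9 := by exact_mod_cast hd9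
  have hmeas : Measurable fun u : ℝ => (10 : ℝ) ^ u := by fun_prop
  rw [significandLaw, integral_map hmeas.aemeasurable
    (measurable_cellPow d m).aestronglyMeasurable]
  have h : (fun u : ℝ => cellPow d m ((10 : ℝ) ^ u)) =
      Set.indicator (Set.Ico (Real.logb 10 d) (Real.logb 10 ((d : ℝ) + 1)))
        (fun u => ((10 : ℝ) ^ u) ^ m) := by
    ext u
    by_cases hu : (10 : ℝ) ^ u ∈ Set.Ico (d : ℝ) (d + 1)
    · rw [cellPow, Set.indicator_of_mem hu, Set.indicator_of_mem ((rpow_mem_cell_iff hd u).1 hu)]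
    · rw [cellPow, Set.indicator_of_notMem hu,
        Set.indicator_of_notMem (mt (rpow_mem_cell_iff hd u).2 hu)]
  -- For 1 ≤ d ≤ 9 the logarithmic cell lies inside [0, 1), so restricting the uniform law cuts
  -- nothing off.
  have hsub : Set.Ico (Real.logb 10 d) (Real.logb 10 ((d : ℝ) + 1)) ⊆ Set.Ico 0 1 := by
    refine Set.Ico_subset_Ico (Real.logb_nonneg (by norm_num) hd1) ?_
    rw [Real.logb_le_iff_le_rpow (by norm_num) (by positivity)]
    norm_num
    linarith
  rw [h, setIntegral_indicator measurableSet_Ico, Set.inter_eq_right.2 hsub,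
    integral_Ico_eq_integral_Ioc, intervalIntegral.integral_of_le]
  exact Real.logb_le_logb_of_le (by norm_num) (by positivity) (by linarith)

lemma integral_cellPow_zero {d : ℕ} (hd : 1 ≤ d) (hd9 : d ≤ 9) :
    ∫ s, cellPow d 0 s ∂significandLaw = p d := by
  simp [integral_cellPow hd hd9, p_eq_sub hd]

lemma integral_cellPow_succ {d : ℕ} (hd : 1 ≤ d) (hd9 : d ≤ 9) (m : ℕ) :
    ∫ s, cellPow d (m + 1) s ∂significandLaw =
      C * ((((d : ℝ) + 1) ^ (m + 1) - (d : ℝ) ^ (m + 1)) / (m + 1)) := by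
  have hd0 : (0 : ℝ) < d := by positivity
  have hlog := log_ten_pos
  have hderiv : ∀ u : ℝ, HasDerivAt (fun u : ℝ => ((10 : ℝ) ^ u) ^ (m + 1) / ((m + 1) * Real.log 10))
      (((10 : ℝ) ^ u) ^ (m + 1)) u := fun u => by
    have h1 : HasDerivAt (fun u : ℝ => (10 : ℝ) ^ u) (Real.log 10 * 1 * (10 : ℝ) ^ u) u :=
      (hasDerivAt_id u).const_rpow (by norm_num)
    have h2 := (h1.fun_pow (m + 1)).div_const ((m + 1) * Real.log 10)
    refine h2.congr_deriv ?_
    have : (m : ℝ) + 1 ≠ 0 := by positivity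
    push_cast
    field_simp
    simp [pow_succ, mul_comm]
  rw [integral_cellPow hd hd9, intervalIntegral.integral_eq_sub_of_hasDerivAt
    (fun u _ => hderiv u) (Continuous.intervalIntegrable (by
      have : Continuous fun u : ℝ => (10 : ℝ) ^ u := Real.continuous_const_rpow (by norm_num)
      fun_prop) _ _),
    Real.rpow_logb (by norm_num) (by norm_num) hd0,
    Real.rpow_logb (by norm_num) (by norm_num) (by positivity), C_eq]
  have : (m : ℝ) + 1 ≠ 0 := by positivity
  field_simp

end Benford

/-! ### Mean and covariance of Z. -/

namespace Benford

/-- The first digit to which a coordinate of `Z` refers. -/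
def digit : Fin 8 ⊕ Fin 9 → ℕ := Sum.elim (fun i => i.val + 1) (fun i => i.val + 1)

/-- The power of the significand which occurs in a coordinate of `Z`. -/
def degree : Fin 8 ⊕ Fin 9 → ℕ := Sum.elim (fun _ => 0) (fun _ => 1)

lemma one_le_digit (i : Fin 8 ⊕ Fin 9) : 1 ≤ digit i := by
  rcases i with i | i <;> simp [digit]

lemma digit_le_nine (i : Fin 8 ⊕ Fin 9) : digit i ≤ 9 := by
  rcases i with i | i <;> simp only [digit, Sum.elim_inl, Sum.elim_inr] <;> omega

lemma Z_eq_cellPow (x : ℝ) (i : Fin 8 ⊕ Fin 9) :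
    Z x i = cellPow (digit i) (degree i) (significand x) := by
  rcases i with i | i
  · simp [Z, Z₁, cellPow, digit, degree]
  · simp only [Z, Z₂, Z₁, cellPow, digit, degree, Sum.elim_inr, pow_one, Set.indicator_apply]
    split_ifs <;> simp

lemma cell_disjoint {d e : ℕ} (h : d ≠ e) {s : ℝ} (hd : s ∈ Set.Ico (d : ℝ) (d + 1)) :
    s ∉ Set.Ico (e : ℝ) (e + 1) := fun he => h <| by
  have h1 : (d : ℝ) < e + 1 := hd.1.trans_lt he.2
  have h2 : (e : ℝ) < d + 1 := he.1.trans_lt hd.2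
  norm_cast at h1 h2
  omega

lemma cellPow_mul_cellPow (d e m n : ℕ) (s : ℝ) :
    cellPow d m s * cellPow e n s = if d = e then cellPow d (m + n) s else 0 := by
  split_ifs with h
  · subst h
    simp only [cellPow, Set.indicator_apply]
    split_ifs <;> simp [pow_add]
  · simp only [cellPow, Set.indicator_apply]
    by_cases hd : s ∈ Set.Ico (d : ℝ) (d + 1)
    · rw [if_neg (cell_disjoint h hd), mul_zero]
    · rw [if_neg hd, zero_mul]

lemma measurable_Z (i : Fin 8 ⊕ Fin 9) : Measurable fun x => Z x i := by
  simp only [Z_eq_cellPow]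
  exact (measurable_cellPow _ _).comp measurable_significand

lemma abs_Z_le (x : ℝ) (i : Fin 8 ⊕ Fin 9) : |Z x i| ≤ 10 := by
  have h1 := one_le_significand x
  have h2 := significand_lt_ten x
  rw [Z_eq_cellPow, cellPow, Set.indicator_apply]
  rcases i with i | i <;> split_ifs <;> simp [degree]
  rw [abs_of_nonneg (by linarith)]
  exact h2.le

section Moments

variable {Ω : Type*} [MeasurableSpace Ω] {P : Measure Ω} {X : Ω → ℝ}

lemma IsBenford.integral_cellPow (hX : IsBenford X P) (d m : ℕ) :
    ∫ ω, cellPow d m (significand (X ω)) ∂P = ∫ s, cellPow d m s ∂significandLaw :=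
  hX.hasLaw.integral_comp (measurable_cellPow d m).aestronglyMeasurable

lemma IsBenford.integral_Z (hX : IsBenford X P) (i : Fin 8 ⊕ Fin 9) :
    ∫ ω, Z (X ω) i ∂P = μ i := by
  simp only [Z_eq_cellPow, hX.integral_cellPow]
  rcases i with i | i
  · exact integral_cellPow_zero (one_le_digit (.inl i)) (digit_le_nine (.inl i))
  · have := integral_cellPow_succ (one_le_digit (.inr i)) (digit_le_nine (.inr i)) 0
    rw [zero_add] at this
    refine this.trans ?_
    simp [μ]

variable [IsProbabilityMeasure P]

lemma IsBenford.memLp_Z (hX : IsBenford X P) (i : Fin 8 ⊕ Fin 9) :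
    MemLp (fun ω => Z (X ω) i) 2 P :=
  .of_bound ((measurable_Z i).comp_aemeasurable hX.aemeasurable).aestronglyMeasurable 10
    (.of_forall fun ω => by simpa using abs_Z_le (X ω) i)

lemma IsBenford.covariance_Z (hX : IsBenford X P) (i j : Fin 8 ⊕ Fin 9) :
    cov[fun ω => Z (X ω) i, fun ω => Z (X ω) j; P] = covZ i j := by
  rw [covariance_eq_sub (hX.memLp_Z i) (hX.memLp_Z j), hX.integral_Z, hX.integral_Z]
  -- Distinct digit cells are disjoint, so mixed moments survive only for equal digits, where the
  -- degrees add.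
  have h : ∫ ω, ((fun ω => Z (X ω) i) * fun ω => Z (X ω) j) ω ∂P =
      if digit i = digit j then ∫ s, cellPow (digit i) (degree i + degree j) s ∂significandLaw
      else 0 := by
    simp only [Pi.mul_apply, Z_eq_cellPow, cellPow_mul_cellPow]
    split_ifs
    · exact hX.integral_cellPow _ _
    · simp
  rw [h]
  have h0 := integral_cellPow_zero (one_le_digit i) (digit_le_nine i)
  have h1 := integral_cellPow_succ (one_le_digit i) (digit_le_nine i) 0
  have h2 := integral_cellPow_succ (one_le_digit i) (digit_le_nine i) 1
  have e2 : C * ((((digit i : ℝ) + 1) ^ (1 + 1) - (digit i : ℝ) ^ (1 + 1)) / ((1 : ℕ) + 1)) =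
      C * ((digit i : ℝ) + 1 / 2) := by
    push_cast
    ring
  rw [e2] at h2
  rcases i with i | i <;> rcases j with j | j <;>
    simp only [digit, degree, Sum.elim_inl, Sum.elim_inr, zero_add, add_zero, one_add_one_eq_two,
      add_left_inj, Fin.val_inj, μ, covZ, cov₁, cov₁₂, cov₂, Matrix.fromBlocks_apply₁₁,
      Matrix.fromBlocks_apply₁₂, Matrix.fromBlocks_apply₂₁, Matrix.fromBlocks_apply₂₂,
      Matrix.transpose_apply, Matrix.of_apply] at h0 h1 h2 ⊢
  · rw [h0]
  · rw [h1]
    simp [mul_comm]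
  · rw [h1]
    simp [eq_comm]
  · rw [h2]
    simp [pow_two]

end Moments

/-! ### Nonsingularity of the covariance matrix. -/

/-- Read `covZ` as the second-moment matrix minus μμᵀ: the bracketed sum is μ ⬝ x, and the other
terms couple only coordinates of the same digit. Digit 9 has no indicator coordinate, hence its
separate row formula below. -/
lemma mulVec_covZ_inl (x : Fin 8 ⊕ Fin 9 → ℝ) (i : Fin 8) :
    (covZ *ᵥ x) (.inl i) = p (i.val + 1) * x (.inl i) + C * x (.inr i.castSucc) -
      p (i.val + 1) * (∑ j : Fin 8, p (j.val + 1) * x (.inl j) + C * ∑ j : Fin 9, x (.inr j)) := by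
  have h : ∀ j : Fin 9, (i.val = j.val) ↔ i.castSucc = j := fun j => by simp [Fin.ext_iff]
  simp only [Matrix.mulVec, dotProduct, Fintype.sum_sum_type, covZ, Matrix.fromBlocks_apply₁₁,
    Matrix.fromBlocks_apply₁₂, cov₁, cov₁₂, Matrix.of_apply, h, sub_mul, Finset.sum_sub_distrib,
    ite_mul, zero_mul, Finset.sum_ite_eq, Finset.mem_univ, if_true, mul_assoc, ← Finset.mul_sum]
  ring

lemma mulVec_covZ_inr_castSucc (x : Fin 8 ⊕ Fin 9 → ℝ) (i : Fin 8) :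
    (covZ *ᵥ x) (.inr i.castSucc) = C * (x (.inl i) + ((i.val + 1 : ℕ) + 1 / 2) * x (.inr i.castSucc) -
      (∑ j : Fin 8, p (j.val + 1) * x (.inl j) + C * ∑ j : Fin 9, x (.inr j))) := by
  have h : ∀ j : Fin 8, (j.val = i.val) ↔ j = i := fun j => by simp [Fin.ext_iff]
  simp only [Matrix.mulVec, dotProduct, Fintype.sum_sum_type, covZ, Matrix.fromBlocks_apply₂₁,
    Matrix.fromBlocks_apply₂₂, cov₂, cov₁₂, Matrix.of_apply, Matrix.transpose_apply, Fin.val_castSucc,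
    h, sub_mul, Finset.sum_sub_distrib,
    ite_mul, zero_mul, Finset.sum_ite_eq, Finset.sum_ite_eq', Finset.mem_univ, if_true, mul_assoc,
    ← Finset.mul_sum]
  push_cast
  ring

lemma mulVec_covZ_inr_last (x : Fin 8 ⊕ Fin 9 → ℝ) :
    (covZ *ᵥ x) (.inr (Fin.last 8)) = C * ((9 + 1 / 2) * x (.inr (Fin.last 8)) -
      (∑ j : Fin 8, p (j.val + 1) * x (.inl j) + C * ∑ j : Fin 9, x (.inr j))) := by
  have h : ∀ j : Fin 8, (j.val = 8) ↔ False := fun j => by simp; omega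
  simp only [Matrix.mulVec, dotProduct, Fintype.sum_sum_type, covZ, Matrix.fromBlocks_apply₂₁,
    Matrix.fromBlocks_apply₂₂, cov₂, cov₁₂, Matrix.of_apply, Matrix.transpose_apply, Fin.val_last,
    h, if_false, sub_mul, Finset.sum_sub_distrib,
    ite_mul, zero_mul, Finset.sum_ite_eq, Finset.mem_univ, if_true, mul_assoc,
    ← Finset.mul_sum, Finset.sum_const_zero]
  push_cast
  ring

/-- For a kernel vector x put m = μ ⬝ x. Each digit d ≤ 8 gives a 2 × 2 system with nonzero
determinant by `C_lt_p_mul`, forcing the coefficient of Z_{2,d} to be 0 and that of Z_{1,d} to be m.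
The definition of m and the row of digit 9 then form one more such system, giving m = 0. -/
lemma isUnit_covZ : IsUnit covZ := by
  rw [← Matrix.mulVec_injective_iff_isUnit]
  refine (injective_iff_map_eq_zero covZ.mulVecLin).2 fun x hx => ?_
  replace hx : covZ *ᵥ x = 0 := hx
  set m := ∑ j : Fin 8, p (j.val + 1) * x (.inl j) + C * ∑ j : Fin 9, x (.inr j) with hm
  have hC := C_pos
  have hb : ∀ i : Fin 8, x (.inr i.castSucc) = 0 ∧ x (.inl i) = m := fun i => by
    have h1 := congrFun hx (.inl i)
    have h2 := congrFun hx (.inr i.castSucc)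
    rw [mulVec_covZ_inl, ← hm, Pi.zero_apply] at h1
    rw [mulVec_covZ_inr_castSucc, ← hm, Pi.zero_apply, mul_eq_zero, or_iff_right hC.ne'] at h2
    have h3 := C_lt_p_mul (Nat.le_add_left 1 i.val)
    have hb : x (.inr i.castSucc) = 0 := by
      have : (p (i.val + 1) * ((i.val + 1 : ℕ) + 1 / 2) - C) * x (.inr i.castSucc) = 0 := by
        -- This combination eliminates both `x (.inl i)` and `m`.
        linear_combination p (i.val + 1) * h2 - h1
      exact (mul_eq_zero.1 this).resolve_left (sub_pos.2 h3).ne'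
    refine ⟨hb, ?_⟩
    rw [hb] at h2
    linarith
  have h1 := congrFun hx (.inr (Fin.last 8))
  rw [mulVec_covZ_inr_last, ← hm, Pi.zero_apply, mul_eq_zero, or_iff_right hC.ne'] at h1
  have h3 : C < p 9 * (9 + 1 / 2) := C_lt_p_mul (d := 9) (by norm_num)
  rw [Fin.sum_univ_castSucc (fun j : Fin 9 => x (.inr j))] at hm
  clear_value m
  simp only [hb, Finset.sum_const_zero, zero_add, ← Finset.sum_mul, sum_p_castSucc] at hm
  have hl : x (.inr (Fin.last 8)) = 0 := by
    have : (p 9 * (9 + 1 / 2) - C) * x (.inr (Fin.last 8)) = 0 := by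
      linear_combination p 9 * h1 + hm
    exact (mul_eq_zero.1 this).resolve_left (sub_pos.2 h3).ne'
  have hm0 : m = 0 := by
    rw [hl] at h1
    linarith
  ext (i | i)
  · rw [(hb i).2, hm0, Pi.zero_apply]
  · refine Fin.lastCases hl (fun i => (hb i).1) i

lemma IsBenford.posDef_covZ {Ω : Type*} [MeasurableSpace Ω] {P : Measure Ω}
    [IsProbabilityMeasure P] {X : Ω → ℝ} (hX : IsBenford X P) : covZ.PosDef :=
  (posSemidef_of_covariance (Y := fun ω => Z (X ω)) hX.memLp_Z
    hX.covariance_Z).posDef_iff_isUnit.2 isUnit_covZ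

/-! ### The statistics as quadratic forms in the normalized sum. -/

lemma invQuadForm_cov₁ (h : IsUnit cov₁.det) (w : Fin 8 → ℝ) :
    QuadPair.invQuadForm cov₁ w =
      ∑ i : Fin 8, w i ^ 2 / p (i.val + 1) + (∑ i, w i) ^ 2 / p 9 := by
  have hp : ∀ i : Fin 8, p (i.val + 1) ≠ 0 := fun i => (p_pos (Nat.le_add_left 1 i.val)).ne'
  have hp9 : p 9 ≠ 0 := (p_pos (by norm_num)).ne'
  -- Sherman–Morrison: the inverse of diag(p) - ppᵀ is diag(1/p) plus the all-ones matrix divided by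
  -- 1 - ∑ p_d = p_9.
  set v : Fin 8 → ℝ := fun i => w i / p (i.val + 1) + (∑ j, w j) / p 9 with hv
  have hsum : ∑ j : Fin 8, p (j.val + 1) * v j = (∑ j, w j) / p 9 := by
    simp only [hv, mul_add, mul_div_cancel₀ _ (hp _), Finset.sum_add_distrib, ← Finset.sum_mul,
      sum_p_castSucc]
    field_simp
    ring
  have hcov : cov₁ *ᵥ v = w := by
    ext i
    simp only [Matrix.mulVec, dotProduct, cov₁, Matrix.of_apply, sub_mul, Finset.sum_sub_distrib,
      ite_mul, zero_mul, Finset.sum_ite_eq, Finset.mem_univ, if_true, mul_assoc, ← Finset.mul_sum,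
      hsum]
    simp only [hv]
    field_simp [hp i]
    ring
  have hinv : cov₁⁻¹ *ᵥ w = v := by
    rw [← hcov, Matrix.mulVec_mulVec, Matrix.nonsing_inv_mul _ h, Matrix.one_mulVec]
  rw [QuadPair.invQuadForm, hinv]
  simp only [dotProduct, hv, mul_add, Finset.sum_add_distrib, ← Finset.sum_mul]
  congr 1
  · exact Finset.sum_congr rfl fun i _ => by ring
  · ring

lemma invQuadForm_smul {r : ℕ} (A : Matrix (Fin r) (Fin r) ℝ) (c : ℝ) (x : Fin r → ℝ) :
    QuadPair.invQuadForm A (c • x) = c ^ 2 * QuadPair.invQuadForm A x := by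
  simp only [QuadPair.invQuadForm, Matrix.mulVec_smul, dotProduct_smul, smul_dotProduct,
    smul_eq_mul]
  ring

lemma firstDigit_indicator {d : ℕ} (hd : 1 ≤ d) (x : ℝ) :
    (if firstDigit x = d then 1 else 0 : ℝ) = Z₁ d x := by
  rw [Z₁, Set.indicator_apply, firstDigit]
  simp only [Nat.floor_eq_iff' (Nat.one_le_iff_ne_zero.1 hd), Set.mem_Ico]

lemma sum_Z₁ (x : ℝ) : ∑ i : Fin 9, Z₁ (i.val + 1) x = 1 := by
  have h1 : 1 ≤ firstDigit x := Nat.le_floor (by simpa using one_le_significand x)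
  have h2 : firstDigit x < 10 := by
    have := significand_lt_ten x
    exact (Nat.floor_lt (by linarith [one_le_significand x])).2 (by exact_mod_cast this)
  simp only [← firstDigit_indicator (Nat.le_add_left 1 _)]
  rw [Finset.sum_eq_single (⟨firstDigit x - 1, by omega⟩ : Fin 9)]
  · rw [if_pos (by simp; omega)]
  · intro i _ hi
    rw [if_neg]
    intro h
    exact hi (by ext; simp [h])
  · simp

section Statistics

variable {Ω : Type*} (X : ℕ → Ω → ℝ) (n : ℕ) (ω : Ω)

/-- The normalized sum of the vectors `Z (X k)`, `k < n`. -/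
noncomputable def normalizedSum : EuclideanSpace ℝ (Fin 8 ⊕ Fin 9) :=
  (√n)⁻¹ • (∑ k ∈ Finset.range n, WithLp.toLp 2 (Z (X k ω)) - (n : ℝ) • WithLp.toLp 2 μ)

lemma normalizedSum_apply (i : Fin 8 ⊕ Fin 9) :
    normalizedSum X n ω i = (√n)⁻¹ * (∑ k ∈ Finset.range n, Z (X k ω) i - n * μ i) := by
  simp [normalizedSum]

lemma Q₁_eq_sum : Q₁ X n ω = ∑ i : Fin 9,
    ((√n)⁻¹ * (∑ k ∈ Finset.range n, Z₁ (i.val + 1) (X k ω) - n * p (i.val + 1))) ^ 2 /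
      p (i.val + 1) := by
  rw [Fin.sum_univ_eq_sum_range (fun i => ((√n)⁻¹ *
      (∑ k ∈ Finset.range n, Z₁ (i + 1) (X k ω) - n * p (i + 1))) ^ 2 / p (i + 1)) 9,
    Finset.range_eq_Ico, Finset.sum_Ico_add' (fun i => ((√n)⁻¹ *
      (∑ k ∈ Finset.range n, Z₁ i (X k ω) - n * p i)) ^ 2 / p i) 0 9 1, Q₁]
  refine Finset.sum_congr rfl fun d hd => ?_
  have hd1 : 1 ≤ d := (Finset.mem_Ico.1 hd).1
  -- At n = 0 division by zero makes both sides 0.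
  rcases Nat.eq_zero_or_pos n with rfl | hn
  · simp
  · have hn0 : (n : ℝ) ≠ 0 := by positivity
    have hs : ((√(n : ℝ))⁻¹) ^ 2 = (n : ℝ)⁻¹ := by rw [inv_pow, Real.sq_sqrt n.cast_nonneg]
    have hp := (p_pos hd1).ne'
    simp only [pHat, firstDigit_indicator hd1]
    rw [mul_pow, hs, one_div, mul_inv_cancel_left₀ hn0]
    field_simp

/-- The nine centered counts sum to zero, so the ninth is minus the sum of the other eight; its
square is the extra term in `invQuadForm_cov₁`. -/
lemma Q₁_eq_invQuadForm (h : IsUnit cov₁.det) :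
    Q₁ X n ω = QuadPair.invQuadForm cov₁ (QuadPair.fstBlock (normalizedSum X n ω)) := by
  have hw : ∀ i : Fin 8, QuadPair.fstBlock (normalizedSum X n ω) i =
      (√n)⁻¹ * (∑ k ∈ Finset.range n, Z₁ (i.val + 1) (X k ω) - n * p (i.val + 1)) :=
    fun i => normalizedSum_apply X n ω (.inl i)
  have hzero : ∑ i : Fin 9,
      (√n)⁻¹ * (∑ k ∈ Finset.range n, Z₁ (i.val + 1) (X k ω) - n * p (i.val + 1)) = 0 := by
    rw [← Finset.mul_sum, Finset.sum_sub_distrib, Finset.sum_comm, ← Finset.mul_sum, sum_p]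
    simp [sum_Z₁]
  rw [Fin.sum_univ_castSucc] at hzero
  rw [Q₁_eq_sum, invQuadForm_cov₁ h, Fin.sum_univ_castSucc]
  simp only [Fin.val_castSucc, Fin.val_last, hw] at hzero ⊢
  rw [eq_neg_of_add_eq_zero_left hzero, neg_sq]

lemma Q₂_eq_invQuadForm :
    Q₂ X n ω = QuadPair.invQuadForm cov₂ (QuadPair.sndBlock (normalizedSum X n ω)) := by
  have hw : QuadPair.sndBlock (normalizedSum X n ω) =
      (√n)⁻¹ • fun i : Fin 9 => ∑ k ∈ Finset.range n, Z₂ (i.val + 1) (X k ω) - n * C := by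
    ext i
    exact normalizedSum_apply X n ω (.inr i)
  rcases Nat.eq_zero_or_pos n with rfl | hn
  · rw [hw, invQuadForm_smul]
    simp [Q₂]
  · have hn0 : (n : ℝ) ≠ 0 := by positivity
    have hZ : (fun i => Z₂Bar X n ω i - C) =
        (n : ℝ)⁻¹ • fun i : Fin 9 => ∑ k ∈ Finset.range n, Z₂ (i.val + 1) (X k ω) - n * C := by
      ext i
      simp only [Z₂Bar, Pi.smul_apply, smul_eq_mul]
      field_simp
    rw [Q₂, hZ, hw, invQuadForm_smul, invQuadForm_smul, inv_pow (√(n : ℝ)),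
      Real.sq_sqrt n.cast_nonneg]
    field_simp

lemma statistics_eq_quadPair (h : IsUnit cov₁.det) :
    (Q₁ X n ω, Q₂ X n ω) = QuadPair.quadPair covZ (normalizedSum X n ω) := by
  rw [Q₁_eq_invQuadForm X n ω h, Q₂_eq_invQuadForm, QuadPair.quadPair, covZ,
    Matrix.toBlocks_fromBlocks₁₁, Matrix.toBlocks_fromBlocks₂₂]

end Statistics

lemma tendstoInDistribution_normalizedSum {Ω Ω' : Type*} [MeasurableSpace Ω] [MeasurableSpace Ω']
    {P : Measure Ω} [IsProbabilityMeasure P] {P' : Measure Ω'} [IsProbabilityMeasure P']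
    {X : ℕ → Ω → ℝ} (hindep : iIndepFun X P) (hX : ∀ k, IsBenford (X k) P)
    {Y : Ω' → EuclideanSpace ℝ (Fin 8 ⊕ Fin 9)} (hY : HasLaw Y (multivariateGaussian 0 covZ) P') :
    TendstoInDistribution (normalizedSum X) atTop Y (fun _ => P) P' := by
  have hZ : Measurable fun x => WithLp.toLp 2 (Z x) :=
    (WithLp.measurable_toLp 2 _).comp (measurable_pi_lambda _ measurable_Z)
  have hZ' : Measurable fun s : ℝ => WithLp.toLp 2 fun i : Fin 8 ⊕ Fin 9 =>
      cellPow (digit i) (degree i) s :=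
    (WithLp.measurable_toLp 2 _).comp (measurable_pi_lambda _ fun i => measurable_cellPow _ _)
  -- The X_k need not share a law; Z depends only on the significand, whose law is prescribed.
  have hident : ∀ k, IdentDistrib (fun ω => WithLp.toLp 2 (Z (X k ω)))
      (fun ω => WithLp.toLp 2 (Z (X 0 ω))) P P := fun k => by
    have h : IdentDistrib (fun ω => significand (X k ω)) (fun ω => significand (X 0 ω)) P P :=
      ⟨(hX k).hasLaw.aemeasurable, (hX 0).hasLaw.aemeasurable,
        (hX k).hasLaw.map_eq.trans (hX 0).hasLaw.map_eq.symm⟩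
    have hcell : ∀ x, Z x = fun i => cellPow (digit i) (degree i) (significand x) :=
      fun x => funext fun i => Z_eq_cellPow x i
    simp only [hcell]
    exact h.comp hZ'
  exact tendstoInDistribution_inv_sqrt_smul_sum_sub (m := WithLp.toLp 2 μ) hY (hX 0).memLp_Z
    (hX 0).integral_Z (hX 0).covariance_Z
    (hindep.comp (fun _ x => WithLp.toLp 2 (Z x)) fun _ => hZ) hident

end Benford

/-! ### The theorem and its application. -/

theorem theorem1 :
    -- the general result
    (∀ (Ω : Type*) [MeasurableSpace Ω] (P : Measure Ω) [IsProbabilityMeasure P]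
      (Ω' : Type*) [MeasurableSpace Ω'] (P' : Measure Ω') [IsProbabilityMeasure P']
      (r₁ r₂ : ℕ) (_ : r₁ ≤ r₂)
      (Ψ : Matrix (Fin r₁ ⊕ Fin r₂) (Fin r₁ ⊕ Fin r₂) ℝ) (_ : Ψ.rank = r₁ + r₂)
      (Yn : ℕ → Ω → EuclideanSpace ℝ (Fin r₁ ⊕ Fin r₂))
      (Y : Ω' → EuclideanSpace ℝ (Fin r₁ ⊕ Fin r₂))
      (_ : ∀ n i, MemLp (fun ω => Yn n ω i) 2 P)
      (_ : ∀ n i, ∫ ω, Yn n ω i ∂P = 0)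
      (_ : ∀ n i j, cov[fun ω => Yn n ω i, fun ω => Yn n ω j; P] = Ψ i j)
      (_ : HasLaw Y (multivariateGaussian 0 Ψ) P')
      (_ : TendstoInDistribution Yn atTop Y (fun _ => P) P'),
      TendstoInDistribution (fun n ω => QuadPair.quadPair Ψ (Yn n ω)) atTop
          (fun ω => QuadPair.quadPair Ψ (Y ω)) (fun _ => P) P' ∧
        (∀ t₁ t₂ : ℝ, 0 ≤ t₁ → 0 ≤ t₂ →
          QuadPair.laplace P' (fun ω => QuadPair.quadPair Ψ (Y ω)) t₁ t₂ =
            (1 + 2 * t₂) ^ (-(1 / 2 : ℝ) * ((r₂ : ℝ) - r₁)) *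
              ∏ j ∈ Finset.range r₁,
                (1 + 2 * t₁ + 2 * t₂ + 4 * (1 - QuadPair.canonCorr Ψ j ^ 2) * t₁ * t₂) ^
                  (-(1 / 2 : ℝ))) ∧
        (∀ j, 0 ≤ QuadPair.canonCorr Ψ j ∧ QuadPair.canonCorr Ψ j ≤ 1) ∧
        Antitone (QuadPair.canonCorr Ψ)) ∧
    -- the joint asymptotic null law of the Pearson and Hotelling first-digit statistics
    (∀ (Ω : Type*) [MeasurableSpace Ω] (P : Measure Ω) [IsProbabilityMeasure P]
      (Ω' : Type*) [MeasurableSpace Ω'] (P' : Measure Ω') [IsProbabilityMeasure P']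
      (X : ℕ → Ω → ℝ) (_ : iIndepFun X P) (_ : ∀ k, Benford.IsBenford (X k) P)
      (Y : Ω' → EuclideanSpace ℝ (Fin 8 ⊕ Fin 9))
      (_ : HasLaw Y (multivariateGaussian 0 Benford.covZ) P'),
      (∀ k i, ∫ ω, Benford.Z (X k ω) i ∂P = Benford.μ i) ∧
        (∀ k i j, cov[fun ω => Benford.Z (X k ω) i, fun ω => Benford.Z (X k ω) j; P] =
          Benford.covZ i j) ∧
        TendstoInDistribution (fun n ω => (Benford.Q₁ X n ω, Benford.Q₂ X n ω)) atTop
          (fun ω => QuadPair.quadPair Benford.covZ (Y ω)) (fun _ => P) P' ∧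
        (∀ t₁ t₂ : ℝ, 0 ≤ t₁ → 0 ≤ t₂ →
          QuadPair.laplace P' (fun ω => QuadPair.quadPair Benford.covZ (Y ω)) t₁ t₂ =
            (1 + 2 * t₂) ^ (-(1 / 2 : ℝ)) *
              ∏ j ∈ Finset.range 8,
                (1 + 2 * t₁ + 2 * t₂ +
                  4 * (1 - QuadPair.canonCorr Benford.covZ j ^ 2) * t₁ * t₂) ^
                  (-(1 / 2 : ℝ)))) := by
  refine ⟨?_, ?_⟩
  · intro Ω _ P _ Ω' _ P' _ r₁ r₂ hr Ψ hrank Yn Y hmem _ hcov hY hlim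
    -- `Ψ` is positive semidefinite as the covariance matrix of `Yn 0`, and full rank makes it
    -- definite.
    have hΨ : Ψ.PosDef :=
      (posSemidef_of_covariance (Y := fun ω => Yn 0 ω) (hmem 0) (hcov 0)).posDef_of_rank_eq_card
        (by simpa using hrank)
    exact ⟨hlim.continuous_comp (QuadPair.continuous_quadPair Ψ),
      fun t₁ t₂ h₁ h₂ => QuadPair.laplace_quadPair hΨ hr hY h₁ h₂,
      fun j => ⟨QuadPair.canonCorr_nonneg Ψ j, QuadPair.canonCorr_le_one hΨ j⟩,
      QuadPair.antitone_canonCorr Ψ⟩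
  · intro Ω _ P _ Ω' _ P' _ X hindep hX Y hY
    have hΨ : Benford.covZ.PosDef := (hX 0).posDef_covZ
    have hunit : IsUnit Benford.cov₁.det :=
      (Matrix.isUnit_iff_isUnit_det _).1 (QuadPair.posDef_toBlocks₁₁ hΨ).isUnit
    refine ⟨fun k => (hX k).integral_Z, fun k => (hX k).covariance_Z, ?_, fun t₁ t₂ h₁ h₂ => ?_⟩
    · simp only [Benford.statistics_eq_quadPair X _ _ hunit]
      exact (Benford.tendstoInDistribution_normalizedSum hindep hX hY).continuous_comp
        (QuadPair.continuous_quadPair Benford.covZ)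
    · rw [QuadPair.laplace_quadPair hΨ (by norm_num) hY h₁ h₂]
      norm_num
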